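/- Consider the triangular lattice $\mathbb{T}^2$ in the plane. A \emph{polyiamond} is a nonempty finite set $P$ of (triangular) faces of $\mathbb{T}^2$ that is connected through shared edges. Its area $\|P\|$ is the number of its faces, and its edge-perimeter $p(P)$ is the number of unit edges of $\mathbb{T}^2$ that separate a face in $P$ from a face not in $P$. A \emph{bar} with larger base $l \ge 1$ is the set of $2l-1$ faces obtained from an equilateral lattice triangle of side $l$ by removing the equilateral lattice triangle of side $l-1$ at one of its corners. For an integer $r \ge 1$ let $E(r) = E_{B_0}(r)$ be the regular hexagon of side length $r$ with vertices in the lattice. Going around $E(r)$, attach bars successively along their larger bases to consecutive sides: $E_{B_1}(r)$ is $E(r)$ with a bar of larger base $r$ attached to a side; for $i = 2,\dots,5$, $E_{B_i}(r)$ is $E_{B_{i-1}}(r)$ with a bar of larger base $r+1$ attached to the next side (of length $r+1$); and $E_{B_6}(r) = E(r+1)$ is $E_{B_5}(r)$ with a bar of larger base $r+2$ attached to the last side. A \emph{quasi-regular hexagon} is any set of faces obtained from some $E_{B_i}(r)$, $r \ge 1$, $0 \le i \le 6$, by a lattice translation and a rotation by a multiple of $\pi/3$. \textbf{Lemma.}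 Let $\bar p$ be the edge-perimeter of a quasi-regular hexagon and let $\bar A$ be its area. Then every polyiamond $P$ with $\|P\| = \bar A$ that is not a quasi-regular hexagon satisfies $p(P) \ge \bar p + 2$. -/

import Mathlib

namespace Polyiamond

/-- A vertex of the triangular lattice: `(x, y)` stands for the point `x • e₁ + y • e₂` of the plane,
where `e₁`, `e₂` are unit vectors at angle `π / 3`. -/
abbrev Vertex : Type := ℤ × ℤ

/-- A face (unit triangle) of the triangular lattice.
`⟨x, y, false⟩` is the triangle with vertices `(x, y)`, `(x + 1, y)`, `(x, y + 1)`, and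
`⟨x, y, true⟩` is the triangle with vertices `(x + 1, y)`, `(x, y + 1)`, `(x + 1, y + 1)`. -/
@[ext] structure Face where
  x : ℤ
  y : ℤ
  down : Bool
deriving DecidableEq

/-- The three vertices of a face. -/
def Face.vertices : Face → Finset Vertex
  | ⟨x, y, false⟩ => {(x, y), (x + 1, y), (x, y + 1)}
  | ⟨x, y, true⟩ => {(x + 1, y), (x, y + 1), (x + 1, y + 1)}

/-- The three edges of a face; an edge of the lattice is given by its pair of end points. -/
def Face.edges (f : Face) : Finset (Finset Vertex) := f.vertices.powersetCard 2

/-- Two distinct faces are adjacent when they share an edge (a common vertex is not enough). -/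
def faceGraph : SimpleGraph Face where
  Adj f g := f ≠ g ∧ ∃ e, e ∈ f.edges ∧ e ∈ g.edges
  symm := ⟨fun _ _ h => ⟨h.1.symm, h.2.imp fun _ he => ⟨he.2, he.1⟩⟩⟩
  loopless := ⟨fun _ h => h.1 rfl⟩

/-- A polyiamond: a finite nonempty edge-connected set of faces. -/
def IsPolyiamond (P : Finset Face) : Prop :=
  (faceGraph.induce (P : Set Face)).Connected

/-- The area: the number of triangular units. -/
def area (P : Finset Face) : ℕ := P.card

/-- The boundary: the edges separating a triangular unit of `P` from an empty triangular unit. -/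
def boundary (P : Finset Face) : Set (Finset Vertex) :=
  {e | ∃ f ∈ P, ∃ g ∉ P, e ∈ f.edges ∧ e ∈ g.edges}

theorem boundary_finite (P : Finset Face) : (boundary P).Finite :=
  (P.biUnion Face.edges).finite_toSet.subset fun _ ⟨f, hf, _, _, he, _⟩ =>
    Finset.mem_coe.2 (Finset.mem_biUnion.2 ⟨f, hf, he⟩)

/-- The edge-perimeter: the number of boundary edges. -/
noncomputable def edgePerimeter (P : Finset Face) : ℕ := (boundary P).ncard

/-- The face lies in the strip `f.row ≤ x + y ≤ f.row + 1`, where `(x, y)` are the coordinates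
with respect to `e₁`, `e₂`. (It also lies in the strips `f.x ≤ x ≤ f.x + 1` and
`f.y ≤ y ≤ f.y + 1`.) -/
def Face.row (f : Face) : ℤ := f.x + f.y + if f.down then 1 else 0

/-- The equilateral triangle of side `l` with vertices `(p, q)`, `(p + l, q)`, `(p, q + l)`. -/
def upTriangle (p q : ℤ) (l : ℕ) : Set Face :=
  {f | p ≤ f.x ∧ q ≤ f.y ∧ f.row < p + q + l}

/-- The equilateral triangle of side `l` with vertices `(p, q)`, `(p - l, q)`, `(p, q - l)`. -/
def downTriangle (p q : ℤ) (l : ℕ) : Set Face :=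
  {f | f.x < p ∧ f.y < q ∧ p + q - l ≤ f.row}

/-- The regular hexagon `E(r)` of radius (side length) `r` centred at the vertex `(0, 0)`. -/
def regularHexagon (r : ℕ) : Set Face :=
  {f | -(r : ℤ) ≤ f.x ∧ f.x < r ∧ -(r : ℤ) ≤ f.y ∧ f.y < r ∧ -(r : ℤ) ≤ f.row ∧ f.row < r}

/-- The bars attached one after the other, going around the hexagon `E(r)`; `bar r i` is the
`(i + 1)`-st bar. Each is the difference of an equilateral triangle of side `l` and one of side
`l - 1` with a common corner, where `l = r` for the first bar, `l = r + 1` for the next four and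
`l = r + 2` for the last; its larger base is a full side (of length `l`) of the hexagon obtained
before. -/
def bar (r : ℕ) : ℕ → Set Face
  | 0 => downTriangle r r r \ downTriangle r r (r - 1)
  | 1 => upTriangle (-r) r (r + 1) \ upTriangle (-r) (r + 1) r
  | 2 => downTriangle (-r) (r + 1) (r + 1) \ downTriangle (-r - 1) (r + 1) r
  | 3 => upTriangle (-r - 1) (-r) (r + 1) \ upTriangle (-r - 1) (-r) r
  | 4 => downTriangle r (-r) (r + 1) \ downTriangle r (-r - 1) r
  | 5 => upTriangle r (-r - 1) (r + 2) \ upTriangle (r + 1) (-r - 1) (r + 1)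
  | _ => ∅

/-- The hexagon `E_{B_i}(r)` in a fixed position: `E(r)` with the first `i` bars attached.
In particular `hexagonWithBars r 6` is `E(r + 1)`. -/
def hexagonWithBars (r : ℕ) : ℕ → Set Face
  | 0 => regularHexagon r
  | i + 1 => hexagonWithBars r i ∪ bar r i

/-- The translation by the lattice vector `v`. -/
def translateFace (v : Vertex) (f : Face) : Face := ⟨f.x + v.1, f.y + v.2, f.down⟩

/-- The rotation by `π / 3` about the vertex `(0, 0)`, which sends `e₁` to `e₂` and `e₂` to
`e₂ - e₁`. -/
def rotateFace : Face → Face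
  | ⟨x, y, false⟩ => ⟨-y - 1, x + y, true⟩
  | ⟨x, y, true⟩ => ⟨-y - 1, x + y + 1, false⟩

/-- A quasi-regular hexagon: a translate of a rotation by a multiple of `π / 3` of some
`E_{B_i}(r)`, `r ≥ 1`, `0 ≤ i ≤ 6`. -/
def IsQuasiRegularHexagon (P : Finset Face) : Prop :=
  ∃ r i z : ℕ, ∃ v : Vertex, 1 ≤ r ∧ i ≤ 6 ∧
    (P : Set Face) = (fun f => translateFace v (rotateFace^[z] f)) '' hexagonWithBars r i

/-- On vertices, `rotateFace` is the linear map `(x, y) ↦ (-y, x + y)`. -/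
theorem vertices_rotateFace (f : Face) :
    (rotateFace f).vertices = f.vertices.image fun w => (-w.2, w.1 + w.2) := by
  rcases f with ⟨x, y, _ | _⟩ <;> ext ⟨a, b⟩ <;>
    simp only [rotateFace, Face.vertices, Finset.image_insert, Finset.image_singleton,
      Finset.mem_insert, Finset.mem_singleton, Prod.mk.injEq] <;> omega

/-- On vertices, `translateFace v` is `w ↦ w + v`. -/
theorem vertices_translateFace (v : Vertex) (f : Face) :
    (translateFace v f).vertices = f.vertices.image fun w => w + v := by
  rcases f with ⟨x, y, _ | _⟩ <;> ext ⟨a, b⟩ <;>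
    simp only [translateFace, Face.vertices, Finset.image_insert, Finset.image_singleton,
      Finset.mem_insert, Finset.mem_singleton, Prod.ext_iff, Prod.fst_add,
      Prod.snd_add] <;> omega

end Polyiamond

/-!
Measure a set of faces by the strips of the three lattice directions that it meets. Each strip that
meets `P` contributes at least two boundary edges at its ends, and every boundary edge ends two
strips, so `p(P)` is at least the number of strips met. A connected `P` meets an interval of strips
in each direction, hence lies in a lattice hexagon whose perimeter is at most `p(P)`.

A lattice hexagon of perimeter `p` has area `(p² - δ) / 6`, where `δ ≥ 0` measures how far its three
widths, and the two triangles circumscribed to it, are from being equal. Since area and perimeter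
have the same parity, `p` determines `δ` modulo `12`; the quasi-regular hexagons are those with
`p ≥ 6` and `δ ≤ 7`, so they are exactly the ones of maximal area. The parity argument also applies
to `P` itself and improves `p(P) > p̄` to `p(P) ≥ p̄ + 2`.
-/

namespace Polyiamond

open Finset

theorem sum_fin_three_eq_of_ne {M : Type*} [AddCommMonoid M] {c d e : Fin 3} (hcd : c ≠ d)
    (hce : c ≠ e) (hde : d ≠ e) (g : Fin 3 → M) : ∑ k, g k = g c + g d + g e := by
  have huniv : (univ : Finset (Fin 3)) = {c, d, e} := by decide +revert
  rw [huniv, sum_insert (by simp [hcd, hce]), sum_pair hde, add_assoc]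

theorem forall_fin_three {p : Fin 3 → Prop} : (∀ d, p d) ↔ p 0 ∧ p 1 ∧ p 2 :=
  ⟨fun h => ⟨h 0, h 1, h 2⟩, fun ⟨h₀, h₁, h₂⟩ => by
    intro d
    fin_cases d <;> assumption⟩

theorem fin_three_ne_shift (d : Fin 3) : d ≠ d + 1 ∧ d ≠ d + 2 ∧ d + 1 ≠ d + 2 := by
  decide +revert

theorem sum_fin_three_shift {M : Type*} [AddCommMonoid M] (d : Fin 3) (g : Fin 3 → M) :
    ∑ k, g k = g d + g (d + 1) + g (d + 2) :=
  let ⟨h₁, h₂, h₁₂⟩ := fin_three_ne_shift d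
  sum_fin_three_eq_of_ne h₁ h₂ h₁₂ g

theorem exists_shift_of_abs_sub_le_one {w : Fin 3 → ℤ} (hw : ∀ d, |w d - w (d + 1)| ≤ 1) :
    ∃ j : Fin 3, ∀ d, w d = (∑ e, w e + (d + j).val) / 3 := by
  by_contra! h
  obtain ⟨h₀, h₁, h₂⟩ := forall_fin_three.1 h
  simp only [abs_le, forall_fin_three, ← not_forall, Fin.sum_univ_three, Fin.reduceAdd, zero_add,
    add_zero, Fin.val_zero, Fin.val_one, Fin.val_two, ne_eq] at hw h₀ h₁ h₂
  omega

theorem exists_nsmul_one_eq_and_even_iff (j : Fin 3) (p : Prop) :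
    ∃ z : ℕ, z • (1 : Fin 3) = j ∧ (Even z ↔ p) := by
  by_cases hp : Even j.val ↔ p
  · exact ⟨j, by fin_cases j <;> rfl, hp⟩
  · refine ⟨j + 3, by fin_cases j <;> rfl, ?_⟩
    rw [Nat.even_add]
    have : ¬ Even 3 := by decide
    tauto

theorem ordConnected_range_of_adj_le_add_one {V : Type*} {G : SimpleGraph V}
    (hG : G.Preconnected) {c : V → ℤ} (hc : ∀ v w, G.Adj v w → c w ≤ c v + 1) :
    (Set.range c).OrdConnected := by
  refine ⟨?_⟩
  rintro _ ⟨v, rfl⟩ _ ⟨w, rfl⟩ k ⟨hvk, hkw⟩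
  by_contra hk
  obtain ⟨p⟩ := hG v w
  obtain ⟨a, -, h_fst, h_snd⟩ := p.exists_boundary_dart {u | c u < k}
    (lt_of_le_of_ne hvk fun h => hk ⟨v, h⟩) hkw.not_gt
  have h_step := hc _ _ a.adj
  simp only [Set.mem_ofPred_eq, not_lt] at h_fst h_snd
  exact hk ⟨a.snd, by omega⟩

theorem exists_eq_Ico_of_ordConnected {s : Finset ℤ} (hs : s.Nonempty)
    (h : (s : Set ℤ).OrdConnected) : ∃ a b, s = Ico a b := by
  refine ⟨s.min' hs, s.max' hs + 1, Subset.antisymm (fun k hk => ?_) fun k hk => ?_⟩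
  · exact mem_Ico.2 ⟨s.min'_le k hk, Int.lt_add_one_of_le (s.le_max' k hk)⟩
  · rw [mem_Ico, Int.lt_add_one_iff] at hk
    exact h.out (s.min'_mem hs) (s.max'_mem hs) hk

section Exits

variable {α β : Type*} [DecidableEq α] [DecidableEq β]

/-- The elements of `P` at which the step `s` leaves `P`. -/
def exits (s : α → α) (P : Finset α) : Finset α := {f ∈ P | s f ∉ P}

theorem mem_exits {s : α → α} {P : Finset α} {f : α} : f ∈ exits s P ↔ f ∈ P ∧ s f ∉ P :=
  mem_filter

theorem card_exits_modEq_two {s : α → α} (hs : Function.Involutive s) (hne : ∀ f, s f ≠ f)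
    (P : Finset α) : #(exits s P) ≡ #P [MOD 2] := by
  have h_even : (#{f ∈ P | s f ∈ P} : ZMod 2) = 0 := by
    rw [card_eq_sum_ones, Nat.cast_sum]
    refine sum_involution (fun f _ => s f) (fun _ _ => by decide) (fun f _ _ => hne f)
      (fun f hf => ?_) fun f _ => hs f
    rw [mem_filter] at hf ⊢
    exact ⟨hf.2, by rw [hs f]; exact hf.1⟩
  rw [← ZMod.natCast_eq_natCast_iff, ← card_filter_add_card_filter_not (s := P) (fun f => s f ∈ P),
    Nat.cast_add, h_even, zero_add, exits]

theorem card_image_le_card_exits {s : α → α} {γ : Type*} [LinearOrder γ] {c : α → β}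
    {pos : α → γ} (hc : ∀ f, c (s f) = c f) (hpos : ∀ f, pos f < pos (s f)) (P : Finset α) :
    #(P.image c) ≤ #(exits s P) := by
  refine (card_le_card fun k hk => ?_).trans (card_image_le (s := exits s P) (f := c))
  obtain ⟨f, hf, rfl⟩ := mem_image.1 hk
  obtain ⟨g, hg, hmax⟩ := exists_max_image {g ∈ P | c g = c f} pos ⟨f, by simp [hf]⟩
  rw [mem_filter] at hg
  refine mem_image.2 ⟨g, mem_exits.2 ⟨hg.1, fun hsg => ?_⟩, hg.2⟩
  exact (hpos g).not_ge (hmax (s g) (mem_filter.2 ⟨hsg, (hc g).trans hg.2⟩))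

end Exits

/-- The barycentric strip coordinates of a face: it lies in the strips
`f.coord 0 ≤ x ≤ f.coord 0 + 1`, `f.coord 1 ≤ y ≤ f.coord 1 + 1` and
`f.coord 2 ≤ -(x + y) ≤ f.coord 2 + 1`. The sign in the last one, opposite to `Face.row`, makes the
lattice symmetric in the three coordinates. -/
def Face.coord (f : Face) : Fin 3 → ℤ := ![f.x, f.y, -f.row - 1]

@[simp] theorem Face.coord_zero (f : Face) : f.coord 0 = f.x := rfl

@[simp] theorem Face.coord_one (f : Face) : f.coord 1 = f.y := rfl

@[simp] theorem Face.coord_two (f : Face) : f.coord 2 = -f.row - 1 := rfl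

@[simp] theorem Face.row_mk_false (x y : ℤ) : Face.row ⟨x, y, false⟩ = x + y := by simp [Face.row]

@[simp] theorem Face.row_mk_true (x y : ℤ) : Face.row ⟨x, y, true⟩ = x + y + 1 := by
  simp [Face.row]

theorem Face.sum_coord (f : Face) : ∑ d, f.coord d = if f.down then -2 else -1 := by
  rw [Fin.sum_univ_three, coord_zero, coord_one, coord_two, row]
  split_ifs <;> ring

theorem Face.coord_injective : Function.Injective Face.coord := by
  rintro ⟨x, y, b⟩ ⟨x', y', b'⟩ h
  obtain ⟨hx, hy, hrow⟩ := forall_fin_three.1 (congrFun h)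
  rcases b <;> rcases b' <;>
    simp only [coord_zero, coord_one, coord_two, row_mk_false, row_mk_true, Face.mk.injEq,
      reduceCtorEq, and_true, and_false] at hx hy hrow ⊢ <;>
    omega

/-- The face on the other side of the edge of `f` that is parallel to the strips of
coordinate `d`. -/
def neighbor : Fin 3 → Face → Face
  | 0, ⟨x, y, false⟩ => ⟨x - 1, y, true⟩
  | 0, ⟨x, y, true⟩ => ⟨x + 1, y, false⟩
  | 1, ⟨x, y, false⟩ => ⟨x, y - 1, true⟩
  | 1, ⟨x, y, true⟩ => ⟨x, y + 1, false⟩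
  | 2, ⟨x, y, b⟩ => ⟨x, y, !b⟩

/-- The edge between `f` and `neighbor d f`. -/
def sharedEdge : Fin 3 → Face → Finset Vertex
  | 0, ⟨x, y, false⟩ => {(x, y), (x, y + 1)}
  | 0, ⟨x, y, true⟩ => {(x + 1, y), (x + 1, y + 1)}
  | 1, ⟨x, y, false⟩ => {(x, y), (x + 1, y)}
  | 1, ⟨x, y, true⟩ => {(x, y + 1), (x + 1, y + 1)}
  | 2, ⟨x, y, _⟩ => {(x + 1, y), (x, y + 1)}

theorem down_neighbor (d : Fin 3) (f : Face) : (neighbor d f).down = !f.down := by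
  rcases f with ⟨x, y, _ | _⟩ <;> fin_cases d <;> rfl

theorem coord_neighbor (d e : Fin 3) (f : Face) : (neighbor d f).coord e =
    f.coord e + if e = d then (if f.down then 1 else -1) else 0 := by
  revert d e
  rcases f with ⟨x, y, _ | _⟩ <;>
    simp only [forall_fin_three, neighbor, Face.coord_zero, Face.coord_one, Face.coord_two,
      Face.row_mk_false, Face.row_mk_true, Bool.not_false, Bool.not_true, Fin.reduceEq, if_true,
      if_false, Bool.false_eq_true, true_and] <;>
    omega

theorem neighbor_involutive (d : Fin 3) : Function.Involutive (neighbor d) := by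
  rintro ⟨x, y, _ | _⟩ <;> fin_cases d <;> simp [neighbor]

theorem neighbor_ne_self (d : Fin 3) (f : Face) : neighbor d f ≠ f := fun h => by
  have h_down := down_neighbor d f
  rw [h] at h_down
  exact Bool.not_ne_self _ h_down.symm

theorem sharedEdge_neighbor (d : Fin 3) (f : Face) :
    sharedEdge d (neighbor d f) = sharedEdge d f := by
  rcases f with ⟨x, y, _ | _⟩ <;> fin_cases d <;> simp [neighbor, sharedEdge]

theorem sharedEdge_eq_sharedEdge_iff {d d' : Fin 3} {f g : Face} :
    sharedEdge d f = sharedEdge d' g ↔ d = d' ∧ (g = f ∨ g = neighbor d f) := by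
  constructor
  · intro h
    -- The midpoint of an edge determines the edge and hence the two faces on its sides.
    have h_fst := congrArg (fun e : Finset Vertex => ∑ v ∈ e, v.1) h
    have h_snd := congrArg (fun e : Finset Vertex => ∑ v ∈ e, v.2) h
    rcases f with ⟨x, y, _ | _⟩ <;> rcases g with ⟨x', y', _ | _⟩ <;> fin_cases d <;>
      fin_cases d' <;> simp [sharedEdge, neighbor] at h_fst h_snd ⊢ <;> omega
  · rintro ⟨rfl, rfl | rfl⟩
    · rfl
    · exact (sharedEdge_neighbor d f).symm

theorem edges_eq_image_sharedEdge (f : Face) :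
    f.edges = univ.image fun d => sharedEdge d f := by
  symm
  apply eq_of_subset_of_card_le
  · rw [image_subset_iff]
    intro d _
    rw [Face.edges, mem_powersetCard]
    rcases f with ⟨x, y, _ | _⟩ <;> fin_cases d <;>
      simp [sharedEdge, Face.vertices, insert_subset_iff]
  · have hinj : Function.Injective fun d => sharedEdge d f :=
      fun _ _ h => (sharedEdge_eq_sharedEdge_iff.1 h).1
    have hvert : #f.vertices = 3 := by
      rcases f with ⟨x, y, _ | _⟩ <;>
        exact card_eq_three.2 ⟨_, _, _, by simp, by simp, by simp, rfl⟩
    rw [Face.edges, card_powersetCard, hvert, card_image_of_injective _ hinj]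
    simp

theorem mem_edges_iff {f : Face} {e : Finset Vertex} : e ∈ f.edges ↔ ∃ d, sharedEdge d f = e := by
  simp [edges_eq_image_sharedEdge]

theorem exists_eq_neighbor_of_mem_edges {f g : Face} {e : Finset Vertex} (hf : e ∈ f.edges)
    (hg : e ∈ g.edges) (hne : g ≠ f) : ∃ d, sharedEdge d f = e ∧ g = neighbor d f := by
  obtain ⟨d, rfl⟩ := mem_edges_iff.1 hf
  obtain ⟨d', h⟩ := mem_edges_iff.1 hg
  exact ⟨d, rfl, (sharedEdge_eq_sharedEdge_iff.1 h.symm).2.resolve_left hne⟩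

theorem boundary_eq_image_exits (P : Finset Face) :
    boundary P = ((univ.sigma fun d => exits (neighbor d) P).image fun a => sharedEdge a.1 a.2 :
      Finset (Finset Vertex)) := by
  ext e
  simp only [boundary, coe_image, Set.mem_ofPred_eq, Set.mem_image, mem_coe, mem_sigma,
    mem_univ, true_and, Sigma.exists, mem_exits]
  constructor
  · rintro ⟨f, hf, g, hg, hef, heg⟩
    obtain ⟨d, rfl, rfl⟩ := exists_eq_neighbor_of_mem_edges hef heg (by rintro rfl; exact hg hf)
    exact ⟨d, f, ⟨hf, hg⟩, rfl⟩
  · rintro ⟨d, f, ⟨hf, hg⟩, rfl⟩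
    exact ⟨f, hf, _, hg, mem_edges_iff.2 ⟨d, rfl⟩, mem_edges_iff.2 ⟨d, sharedEdge_neighbor d f⟩⟩

theorem edgePerimeter_eq_sum_card_exits (P : Finset Face) :
    edgePerimeter P = ∑ d, #(exits (neighbor d) P) := by
  rw [edgePerimeter, boundary_eq_image_exits, Set.ncard_coe_finset, card_image_of_injOn,
    card_sigma]
  rintro ⟨d, f⟩ hf ⟨d', g⟩ hg (h : sharedEdge d f = sharedEdge d' g)
  simp only [coe_sigma, Set.mem_sigma_iff, mem_coe, mem_exits] at hf hg
  obtain ⟨rfl, rfl | rfl⟩ := sharedEdge_eq_sharedEdge_iff.1 h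
  · rfl
  · exact absurd hg.2.1 hf.2.2

theorem edgePerimeter_modEq_area (P : Finset Face) : edgePerimeter P ≡ area P [MOD 2] := by
  have h := fun d => card_exits_modEq_two (neighbor_involutive d) (neighbor_ne_self d) P
  have h0 := h 0
  have h1 := h 1
  have h2 := h 2
  rw [edgePerimeter_eq_sum_card_exits, Fin.sum_univ_three, area]
  unfold Nat.ModEq at *
  omega

/-- The step that leaves an up-pointing face in direction `d` and a down-pointing one in direction
`e`. For `d ≠ e`, iterating it runs along a strip of the third coordinate. -/
def stripStep (d e : Fin 3) (f : Face) : Face := neighbor (if f.down then e else d) f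

theorem coord_stripStep {c d e : Fin 3} (hcd : c ≠ d) (hce : c ≠ e) (f : Face) :
    (stripStep d e f).coord c = f.coord c := by
  rw [stripStep, coord_neighbor, if_neg (by split_ifs <;> assumption), add_zero]

theorem coord_sub_coord_stripStep {d e : Fin 3} (hde : d ≠ e) (f : Face) :
    (stripStep d e f).coord e - (stripStep d e f).coord d = f.coord e - f.coord d + 1 := by
  cases h : f.down <;>
    simp only [stripStep, coord_neighbor, h, if_true, if_false, if_neg hde, if_neg hde.symm,
      Bool.false_eq_true] <;>
    ring

theorem card_exits_stripStep_add (d e : Fin 3) (P : Finset Face) :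
    #(exits (stripStep d e) P) + #(exits (stripStep e d) P) =
      #(exits (neighbor d) P) + #(exits (neighbor e) P) := by
  simp only [exits, card_filter, ← sum_add_distrib]
  refine sum_congr rfl fun f _ => ?_
  cases h : f.down <;> simp [stripStep, h, add_comm]

theorem two_mul_edgePerimeter (P : Finset Face) : 2 * edgePerimeter P =
    ∑ c : Fin 3, (#(exits (stripStep (c + 1) (c + 2)) P) +
      #(exits (stripStep (c + 2) (c + 1)) P)) := by
  simp only [card_exits_stripStep_add, edgePerimeter_eq_sum_card_exits, Fin.sum_univ_three,
    Fin.isValue, Fin.reduceAdd, zero_add]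
  ring

theorem sum_card_image_coord_le_edgePerimeter (P : Finset Face) :
    ∑ d, #(P.image (·.coord d)) ≤ edgePerimeter P := by
  have h_strip {c d e : Fin 3} (hcd : c ≠ d) (hce : c ≠ e) (hde : d ≠ e) :
      #(P.image (·.coord c)) ≤ #(exits (stripStep d e) P) :=
    card_image_le_card_exits (pos := fun f => f.coord e - f.coord d) (coord_stripStep hcd hce)
      (fun f => by rw [coord_sub_coord_stripStep hde]; omega) P
  have h_two : 2 * ∑ c, #(P.image (·.coord c)) ≤ 2 * edgePerimeter P := by
    rw [two_mul_edgePerimeter, mul_sum]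
    refine sum_le_sum fun c _ => ?_
    obtain ⟨h₁, h₂, h₁₂⟩ := fin_three_ne_shift c
    rw [two_mul]
    exact add_le_add (h_strip h₁ h₂ h₁₂) (h_strip h₂ h₁ h₁₂.symm)
  omega

/-- A lattice hexagon, given by its bounds in the three strip coordinates: the face `f` belongs to
it when `lower d ≤ f.coord d < upper d` for all `d`. -/
@[ext] structure Hexagon where
  lower : Fin 3 → ℤ
  upper : Fin 3 → ℤ

namespace Hexagon

variable {h : Hexagon}

/-- The set of faces of a hexagon. -/
noncomputable def faces (h : Hexagon) : Finset Face :=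
  (Fintype.piFinset fun d => Ico (h.lower d) (h.upper d)).preimage Face.coord
    Face.coord_injective.injOn

theorem mem_faces {f : Face} :
    f ∈ h.faces ↔ ∀ d, h.lower d ≤ f.coord d ∧ f.coord d < h.upper d := by
  simp [faces]

/-- The number of strips of coordinate `d` that meet the hexagon. -/
def width (h : Hexagon) (d : Fin 3) : ℤ := h.upper d - h.lower d

/-- The side of the up-pointing triangle cut out by the three lower bounds. -/
def upSize (h : Hexagon) : ℤ := -∑ d, h.lower d

/-- The side of the down-pointing triangle cut out by the three upper bounds. -/
def downSize (h : Hexagon) : ℤ := ∑ d, h.upper d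

/-- The sum of the widths, which for a tight hexagon is the number of its boundary edges. -/
def perimeter (h : Hexagon) : ℤ := ∑ d, h.width d

/-- All six bounds are attained. The two differences `upSize - width d` and `downSize - width d`
are the lengths of the two sides parallel to the strips of coordinate `d`. -/
def IsTight (h : Hexagon) : Prop := ∀ d, h.width d ≤ h.upSize ∧ h.width d ≤ h.downSize

/-- The isoperimetric deficit: for a tight hexagon this is `perimeter ^ 2 - 6 * area`, see
`IsTight.six_mul_card_faces`. -/
def deficit (h : Hexagon) : ℤ :=
  3 * (h.upSize - h.downSize) ^ 2 + 2 * ∑ d, (h.width d - h.width (d + 1)) ^ 2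

theorem perimeter_eq_upSize_add_downSize (h : Hexagon) :
    h.perimeter = h.upSize + h.downSize := by
  simp only [perimeter, width, upSize, downSize, sum_sub_distrib]
  ring

theorem deficit_nonneg (h : Hexagon) : 0 ≤ h.deficit := by
  unfold deficit
  positivity

theorem IsTight.width_nonneg (hh : h.IsTight) (d : Fin 3) : 0 ≤ h.width d := by
  have h_sum := h.perimeter_eq_upSize_add_downSize
  rw [perimeter, sum_fin_three_shift d] at h_sum
  have := hh (d + 1)
  have := hh (d + 2)
  omega

/-- The up-pointing triangle with lower bounds `a`. -/
def triangle (a : Fin 3 → ℤ) : Hexagon := ⟨a, fun d => a d - ∑ e, a e⟩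

theorem mem_faces_triangle {a : Fin 3 → ℤ} {f : Face} :
    f ∈ (triangle a).faces ↔ ∀ d, a d ≤ f.coord d := by
  rw [mem_faces]
  refine ⟨fun hf d => (hf d).1, fun hf d => ⟨hf d, ?_⟩⟩
  have h_sum : ∑ e, f.coord e < 0 := by
    rw [f.sum_coord]
    split_ifs <;> norm_num
  have := hf (d + 1)
  have := hf (d + 2)
  rw [sum_fin_three_shift d] at h_sum
  simp only [triangle, sum_fin_three_shift d]
  omega

theorem card_faces_triangle {a : Fin 3 → ℤ} (ha : ∑ d, a d ≤ 0) :
    (#(triangle a).faces : ℤ) = (∑ d, a d) ^ 2 := by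
  obtain ⟨p, hp⟩ : ∃ p, p = a 0 := ⟨_, rfl⟩
  obtain ⟨q, hq⟩ : ∃ q, q = a 1 := ⟨_, rfl⟩
  obtain ⟨l, hl⟩ : ∃ l, l = -∑ d, a d := ⟨_, rfl⟩
  have h_mem (f : Face) : f ∈ (triangle a).faces ↔ p ≤ f.x ∧ q ≤ f.y ∧ f.row < p + q + l := by
    rw [mem_faces_triangle, forall_fin_three, Face.coord_zero, Face.coord_one, Face.coord_two]
    rw [Fin.sum_univ_three] at hl
    omega
  -- Turning the down-pointing faces by `π` fills up a rhombus of side `l`, less one half of it.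
  have h_card : #(triangle a).faces = #(Ico p (p + l) ×ˢ Ico q (q + l)) := by
    refine card_nbij'
      (fun f => if f.down then (2 * p + l - 1 - f.x, 2 * q + l - 1 - f.y) else (f.x, f.y))
      (fun v => if v.1 + v.2 < p + q + l then ⟨v.1, v.2, false⟩
        else ⟨2 * p + l - 1 - v.1, 2 * q + l - 1 - v.2, true⟩) ?_ ?_ ?_ ?_
    · rintro ⟨x, y, _ | _⟩ hf <;> rw [mem_coe, h_mem] at hf <;>
        simp only [coe_product, coe_Ico, Set.mem_prod, Set.mem_Ico, if_true, if_false,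
          Bool.false_eq_true, Face.row_mk_false, Face.row_mk_true] at hf ⊢ <;>
        omega
    · rintro ⟨x, y⟩ hv
      rw [mem_coe, mem_product, mem_Ico, mem_Ico] at hv
      dsimp only at hv ⊢
      split_ifs <;> rw [mem_coe, h_mem] <;>
        simp only [Face.row_mk_false, Face.row_mk_true] <;>
        omega
    · rintro ⟨x, y, _ | _⟩ hf <;> rw [mem_coe, h_mem] at hf <;>
        simp only [if_true, if_false, Bool.false_eq_true, Face.row_mk_false,
          Face.row_mk_true] at hf ⊢
      · rw [if_pos hf.2.2]
      · rw [if_neg (by omega), sub_sub_cancel, sub_sub_cancel]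
    · rintro ⟨x, y⟩ _
      by_cases hxy : x + y < p + q + l <;> simp [hxy]
  rw [h_card, card_product, Int.card_Ico, Int.card_Ico, add_sub_cancel_left, add_sub_cancel_left]
  push_cast
  rw [Int.toNat_of_nonneg (by omega), hl]
  ring

/-- The up-pointing triangle that the bound `upper d` cuts off from the triangle of the three lower
bounds. -/
def corner (h : Hexagon) (d : Fin 3) : Hexagon :=
  triangle (Function.update h.lower d (h.upper d))

theorem mem_faces_corner {d : Fin 3} {f : Face} : f ∈ (h.corner d).faces ↔
    h.upper d ≤ f.coord d ∧ ∀ e ≠ d, h.lower e ≤ f.coord e := by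
  rw [corner, mem_faces_triangle,
    Function.forall_update_iff h.lower (p := fun e k => k ≤ f.coord e)]

theorem sum_update_lower (h : Hexagon) (d : Fin 3) :
    ∑ e, Function.update h.lower d (h.upper d) e = h.width d - h.upSize := by
  obtain ⟨h₁, h₂, -⟩ := fin_three_ne_shift d
  rw [upSize, sum_fin_three_shift d, sum_fin_three_shift d h.lower, Function.update_self,
    Function.update_of_ne h₁.symm, Function.update_of_ne h₂.symm, width]
  ring

theorem IsTight.card_faces_corner (hh : h.IsTight) (d : Fin 3) :
    (#(h.corner d).faces : ℤ) = (h.upSize - h.width d) ^ 2 := by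
  have h_side := (hh d).1
  rw [corner, card_faces_triangle, sum_update_lower]
  · ring
  · rw [sum_update_lower]
    omega

theorem IsTight.pairwiseDisjoint_faces_corner (hh : h.IsTight) :
    (Set.univ : Set (Fin 3)).PairwiseDisjoint fun d => (h.corner d).faces := by
  intro d _ e _ hde
  obtain ⟨c, hcd, hce⟩ : ∃ c : Fin 3, c ≠ d ∧ c ≠ e := by decide +revert
  rw [Function.onFun, disjoint_left]
  intro f hfd hfe
  rw [mem_faces_corner] at hfd hfe
  have h_side := (hh c).2
  have h_lower := hfd.2 c hcd
  have h_sum := f.sum_coord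
  rw [sum_fin_three_eq_of_ne hcd hce hde] at h_sum
  rw [width, downSize, sum_fin_three_eq_of_ne hcd hce hde] at h_side
  split_ifs at h_sum <;> omega

theorem IsTight.faces_triangle_lower (hh : h.IsTight) :
    (triangle h.lower).faces = h.faces ∪ univ.biUnion fun d => (h.corner d).faces := by
  ext f
  simp only [mem_union, mem_biUnion, mem_univ, true_and, mem_faces_triangle, mem_faces_corner,
    mem_faces (h := h)]
  constructor
  · intro hf
    by_cases hfd : ∃ d, h.upper d ≤ f.coord d
    · obtain ⟨d, hd⟩ := hfd
      exact .inr ⟨d, hd, fun e _ => hf e⟩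
    · push Not at hfd
      exact .inl fun d => ⟨hf d, hfd d⟩
  · rintro (hf | ⟨d, hd, hf⟩) e
    · exact (hf e).1
    · by_cases hed : e = d
      · subst hed
        have h_width := hh.width_nonneg e
        unfold width at h_width
        omega
      · exact hf e hed

theorem IsTight.card_faces (hh : h.IsTight) :
    (#h.faces : ℤ) = h.upSize ^ 2 - ∑ d, (h.upSize - h.width d) ^ 2 := by
  have h_disj : Disjoint h.faces (univ.biUnion fun d => (h.corner d).faces) := by
    rw [disjoint_biUnion_right]
    refine fun d _ => disjoint_left.2 fun f hf hfd => ?_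
    exact (mem_faces.1 hf d).2.not_ge (mem_faces_corner.1 hfd).1
  have h_upSize : 0 ≤ h.upSize := (hh.width_nonneg 0).trans (hh 0).1
  have h_card : (#(triangle h.lower).faces : ℤ) = h.upSize ^ 2 := by
    rw [upSize] at h_upSize ⊢
    rw [card_faces_triangle (by omega), neg_sq]
  rw [hh.faces_triangle_lower, card_union_of_disjoint h_disj,
    card_biUnion (by simpa using hh.pairwiseDisjoint_faces_corner)] at h_card
  push_cast [hh.card_faces_corner] at h_card
  linarith

theorem IsTight.six_mul_card_faces (hh : h.IsTight) :
    6 * (#h.faces : ℤ) = h.perimeter ^ 2 - h.deficit := by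
  have h_sum := h.perimeter_eq_upSize_add_downSize
  rw [hh.card_faces, deficit, show h.downSize = h.perimeter - h.upSize by omega, perimeter]
  simp only [Fin.sum_univ_three, Fin.isValue, Fin.reduceAdd, zero_add]
  ring

theorem IsTight.card_faces_modEq_two (hh : h.IsTight) : #h.faces ≡ h.perimeter [ZMOD 2] := by
  have h_even : Even (#h.faces : ℤ) ↔ Even h.perimeter := by
    rw [hh.card_faces, perimeter]
    simp only [Fin.sum_univ_three, Int.even_sub, Int.even_add, Int.even_pow, ne_eq,
      OfNat.ofNat_ne_zero, not_false_eq_true, and_true]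
    tauto
  rw [Int.even_iff, Int.even_iff] at h_even
  unfold Int.ModEq
  omega

theorem stripStep_mem_faces {c d e : Fin 3} (hcd : c ≠ d) (hce : c ≠ e) (hde : d ≠ e) {f f' : Face}
    (hf : f ∈ h.faces) (hf' : f' ∈ h.faces) (hc : f.coord c = f'.coord c)
    (hlt : f.coord e - f.coord d < f'.coord e - f'.coord d) : stripStep d e f ∈ h.faces := by
  have h_sum := f.sum_coord
  have h_sum' := f'.sum_coord
  rw [sum_fin_three_eq_of_ne hcd hce hde] at h_sum h_sum'
  rw [mem_faces] at hf hf' ⊢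
  intro k
  have := hf k
  have := hf' d
  have := hf' e
  rw [stripStep, coord_neighbor]
  split_ifs at h_sum h_sum' ⊢ <;> subst_vars <;> omega

theorem card_exits_stripStep_faces_le {c d e : Fin 3} (hcd : c ≠ d) (hce : c ≠ e) (hde : d ≠ e)
    (h : Hexagon) : #(exits (stripStep d e) h.faces) ≤ (h.width c).toNat := by
  rw [width, ← Int.card_Ico]
  refine card_le_card_of_injOn (·.coord c)
    (fun f hf => mem_Ico.2 (mem_faces.1 (mem_exits.1 hf).1 c)) ?_
  intro f hf f' hf' (hc : f.coord c = f'.coord c)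
  rw [mem_coe, mem_exits] at hf hf'
  have h_le := mt (stripStep_mem_faces hcd hce hde hf.1 hf'.1 hc) hf.2
  have h_ge := mt (stripStep_mem_faces hcd hce hde hf'.1 hf.1 hc.symm) hf'.2
  have h_sum := f.sum_coord
  have h_sum' := f'.sum_coord
  rw [sum_fin_three_eq_of_ne hcd hce hde] at h_sum h_sum'
  apply Face.coord_injective
  funext k
  have h_cases : k = c ∨ k = d ∨ k = e := by
    clear * - hcd hce hde
    decide +revert
  obtain rfl | rfl | rfl := h_cases
  · exact hc
  all_goals split_ifs at h_sum h_sum' <;> omega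

theorem IsTight.edgePerimeter_faces_le (hh : h.IsTight) :
    (edgePerimeter h.faces : ℤ) ≤ h.perimeter := by
  have h_two : (2 * edgePerimeter h.faces : ℤ) ≤ 2 * h.perimeter := by
    rw_mod_cast [two_mul_edgePerimeter]
    push_cast
    rw [perimeter, mul_sum]
    refine sum_le_sum fun c _ => ?_
    obtain ⟨h₁, h₂, h₁₂⟩ := fin_three_ne_shift c
    have h_fwd := card_exits_stripStep_faces_le h₁ h₂ h₁₂ h
    have h_bwd := card_exits_stripStep_faces_le h₂ h₁ h₁₂.symm h
    have h_width := hh.width_nonneg c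
    omega
  omega

/-- The hexagons with perimeter at least `6` whose area is the largest possible for their perimeter:
the perimeter determines the deficit modulo `12`, so a deficit of at most `7` cannot be improved. Up
to translation and rotation they are the `E_{B_i}(r)`, see `isQuasiRegularHexagon_iff`. -/
def IsQuasiRegular (h : Hexagon) : Prop := 6 ≤ h.perimeter ∧ h.deficit ≤ 7

theorem IsQuasiRegular.abs_sub_le_one (hh : h.IsQuasiRegular) :
    |h.upSize - h.downSize| ≤ 1 ∧ ∀ d, |h.width d - h.width (d + 1)| ≤ 1 := by
  have h_abs {a : ℤ} (ha : 2 * a ^ 2 ≤ 7) : |a| ≤ 1 :=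
    Int.lt_add_one_iff.1 (sq_lt_sq₀ (abs_nonneg a) zero_le_two |>.1 (by rw [sq_abs]; omega))
  have h_deficit := hh.2
  unfold deficit at h_deficit
  constructor
  · have h_sum : 0 ≤ ∑ d, (h.width d - h.width (d + 1)) ^ 2 := by positivity
    exact h_abs (by nlinarith)
  · intro d
    have h_single := single_le_sum (f := fun d => (h.width d - h.width (d + 1)) ^ 2)
      (fun d _ => sq_nonneg _) (mem_univ d)
    exact h_abs (by nlinarith [sq_nonneg (h.upSize - h.downSize)])

theorem IsQuasiRegular.isTight (hh : h.IsQuasiRegular) : h.IsTight := by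
  obtain ⟨h_sizes, h_widths⟩ := hh.abs_sub_le_one
  have h_perimeter := hh.1
  intro d
  have h_sum := h.perimeter_eq_upSize_add_downSize
  have h_width := h_widths d
  have h_width' := h_widths (d + 2)
  rw [perimeter, sum_fin_three_shift d] at h_perimeter h_sum
  rw [show d + 2 + 1 = d by rw [add_assoc]; exact add_zero d] at h_width'
  rw [abs_le] at *
  omega

/-- The image of a hexagon under `rotateFace`. -/
def rotate (h : Hexagon) : Hexagon := ⟨fun d => -h.upper (d + 1), fun d => -h.lower (d + 1)⟩

/-- The image of a hexagon under `translateFace v`. -/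
def translate (v : Vertex) (h : Hexagon) : Hexagon :=
  ⟨fun d => h.lower d + ![v.1, v.2, -v.1 - v.2] d,
    fun d => h.upper d + ![v.1, v.2, -v.1 - v.2] d⟩

end Hexagon

theorem coord_rotateFace (f : Face) (d : Fin 3) :
    (rotateFace f).coord d = -f.coord (d + 1) - 1 := by
  revert d
  rcases f with ⟨x, y, _ | _⟩ <;>
    simp only [forall_fin_three, Fin.reduceAdd, zero_add, rotateFace, Face.coord_zero,
      Face.coord_one, Face.coord_two, Face.row_mk_false, Face.row_mk_true, true_and] <;>
    omega

theorem coord_translateFace (v : Vertex) (f : Face) (d : Fin 3) :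
    (translateFace v f).coord d = f.coord d + ![v.1, v.2, -v.1 - v.2] d := by
  revert d
  simp only [forall_fin_three, Face.coord_zero, Face.coord_one, Face.coord_two, Face.row,
    translateFace, Matrix.cons_val, true_and]
  ring

theorem rotateFace_surjective : Function.Surjective rotateFace
  | ⟨x, y, false⟩ => ⟨⟨x + y, -x - 1, true⟩, by
    simp only [rotateFace, Face.mk.injEq, and_true]
    omega⟩
  | ⟨x, y, true⟩ => ⟨⟨x + y + 1, -x - 1, false⟩, by
    simp only [rotateFace, Face.mk.injEq, and_true]
    omega⟩

theorem translateFace_surjective (v : Vertex) : Function.Surjective (translateFace v) :=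
  fun f => ⟨translateFace (-v) f, by simp [translateFace]⟩

namespace Hexagon

variable {h g : Hexagon}

theorem image_rotateFace (h : Hexagon) : rotateFace '' (h.faces : Set Face) = h.rotate.faces := by
  rw [← rotateFace_surjective.image_preimage h.rotate.faces]
  congr 1
  ext f
  simp only [Set.mem_preimage, mem_coe, mem_faces, rotate, coord_rotateFace]
  rw [← (Equiv.addRight 1).forall_congr_right]
  exact forall_congr' fun d => by simp only [Equiv.coe_addRight]; omega

theorem image_translateFace (v : Vertex) (h : Hexagon) :
    translateFace v '' (h.faces : Set Face) = (h.translate v).faces := by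
  rw [← (translateFace_surjective v).image_preimage (h.translate v).faces]
  congr 1
  ext f
  simp [mem_faces, translate, coord_translateFace]

theorem image_rotateFace_iterate (z : ℕ) (h : Hexagon) :
    rotateFace^[z] '' (h.faces : Set Face) = (rotate^[z] h).faces := by
  induction z with
  | zero => simp
  | succ z ih =>
    rw [Function.iterate_succ', Set.image_comp, ih, image_rotateFace,
      Function.iterate_succ_apply']

theorem width_translate (v : Vertex) (h : Hexagon) : (h.translate v).width = h.width := by
  funext d
  simp [width, translate]

theorem upSize_translate (v : Vertex) (h : Hexagon) : (h.translate v).upSize = h.upSize := by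
  simp only [upSize, translate, sum_add_distrib, Fin.sum_univ_three, Matrix.cons_val]
  ring

theorem downSize_translate (v : Vertex) (h : Hexagon) :
    (h.translate v).downSize = h.downSize := by
  simp only [downSize, translate, sum_add_distrib, Fin.sum_univ_three, Matrix.cons_val]
  ring

theorem exists_eq_translate (h_width : h.width = g.width) (h_upSize : h.upSize = g.upSize) :
    ∃ v, h = g.translate v := by
  obtain ⟨v, hv⟩ : ∃ v : Vertex, v = (h.lower 0 - g.lower 0, h.lower 1 - g.lower 1) := ⟨_, rfl⟩
  have h_lower : h.lower = (g.translate v).lower := by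
    rw [upSize, upSize, Fin.sum_univ_three, Fin.sum_univ_three] at h_upSize
    refine funext (forall_fin_three.2 ⟨?_, ?_, ?_⟩) <;>
      simp only [translate, hv, Matrix.cons_val] <;>
      omega
  refine ⟨v, Hexagon.ext h_lower (funext fun d => ?_)⟩
  have h_width := congrFun (h_width.trans (width_translate v g).symm) d
  rw [width, width, h_lower] at h_width
  omega

theorem width_rotate (h : Hexagon) (d : Fin 3) : h.rotate.width d = h.width (d + 1) := by
  simp only [width, rotate]
  ring

theorem width_rotate_iterate (z : ℕ) (h : Hexagon) (d : Fin 3) :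
    (rotate^[z] h).width d = h.width (d + z • 1) := by
  induction z generalizing d with
  | zero => simp
  | succ z ih =>
    rw [Function.iterate_succ_apply', width_rotate, ih, add_assoc, succ_nsmul']

theorem upSize_rotate (h : Hexagon) : h.rotate.upSize = h.downSize := by
  rw [downSize, ← Equiv.sum_comp (Equiv.addRight (1 : Fin 3)) h.upper]
  simp [upSize, rotate]

theorem downSize_rotate (h : Hexagon) : h.rotate.downSize = h.upSize := by
  rw [upSize, ← Equiv.sum_comp (Equiv.addRight (1 : Fin 3)) h.lower]
  simp [downSize, rotate]

theorem upSize_rotate_iterate (z : ℕ) (h : Hexagon) :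
    (rotate^[z] h).upSize = if Even z then h.upSize else h.downSize := by
  induction z generalizing h with
  | zero => simp
  | succ z ih =>
    rw [Function.iterate_succ_apply, ih, upSize_rotate, downSize_rotate]
    simp only [Nat.even_add_one, ite_not]

theorem deficit_rotate (h : Hexagon) : h.rotate.deficit = h.deficit := by
  simp only [deficit, upSize_rotate, downSize_rotate, width_rotate]
  rw [← Equiv.sum_comp (Equiv.addRight (1 : Fin 3)) fun d => (h.width d - h.width (d + 1)) ^ 2]
  simp only [Equiv.coe_addRight]
  ring

theorem IsQuasiRegular.rotate (hh : h.IsQuasiRegular) : h.rotate.IsQuasiRegular := by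
  rw [IsQuasiRegular, perimeter_eq_upSize_add_downSize, upSize_rotate, downSize_rotate, add_comm,
    ← perimeter_eq_upSize_add_downSize, deficit_rotate]
  exact hh

theorem IsQuasiRegular.rotate_iterate (hh : h.IsQuasiRegular) :
    ∀ z, (Hexagon.rotate^[z] h).IsQuasiRegular
  | 0 => hh
  | z + 1 => by
    rw [Function.iterate_succ_apply']
    exact (hh.rotate_iterate z).rotate

theorem IsQuasiRegular.translate (hh : h.IsQuasiRegular) (v : Vertex) :
    (h.translate v).IsQuasiRegular := by
  rw [IsQuasiRegular, perimeter, deficit, width_translate, upSize_translate, downSize_translate]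
  exact hh

/-- The hexagon `E_{B_i}(r)`: attaching the bars one by one moves the six bounds outwards, in the
order `lower 2`, `upper 1`, `lower 0`, `upper 2`, `lower 1`, `upper 0`. -/
def withBars (r i : ℕ) : Hexagon where
  lower d := -r - if ![3, 5, 1] d ≤ i then 1 else 0
  upper d := r + if ![6, 2, 4] d ≤ i then 1 else 0

theorem hexagonWithBars_eq_faces {r i : ℕ} (hr : 1 ≤ r) (hi : i ≤ 6) :
    hexagonWithBars r i = (withBars r i).faces := by
  ext f
  interval_cases i <;> rcases f with ⟨x, y, _ | _⟩ <;>
    simp only [hexagonWithBars, bar, regularHexagon, upTriangle, downTriangle, mem_coe, mem_faces,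
      withBars, forall_fin_three, Set.mem_union, Set.mem_sdiff, Set.mem_ofPred_eq, Face.coord_zero,
      Face.coord_one, Face.coord_two, Face.row_mk_false, Face.row_mk_true, Matrix.cons_val,
      Nat.reduceLeDiff, if_true, if_false] <;>
    omega

theorem width_withBars {r i : ℕ} (hi : i ≤ 6) (d : Fin 3) :
    (withBars r i).width d = (6 * r + i + d.val : ℤ) / 3 := by
  revert d
  simp only [forall_fin_three, width, withBars, Matrix.cons_val, Fin.val_zero, Fin.val_one,
    Fin.val_two]
  split_ifs <;> omega

theorem upSize_withBars {r i : ℕ} (hi : i ≤ 6) :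
    (withBars r i).upSize = (6 * r + i + 1 : ℤ) / 2 := by
  simp only [upSize, withBars, Fin.sum_univ_three, Matrix.cons_val]
  split_ifs <;> omega

theorem downSize_withBars {r i : ℕ} (hi : i ≤ 6) :
    (withBars r i).downSize = (6 * r + i : ℤ) / 2 := by
  simp only [downSize, withBars, Fin.sum_univ_three, Matrix.cons_val]
  split_ifs <;> omega

theorem isQuasiRegular_withBars {r i : ℕ} (hr : 1 ≤ r) (hi : i ≤ 6) :
    (withBars r i).IsQuasiRegular := by
  constructor
  · rw [perimeter_eq_upSize_add_downSize, upSize_withBars hi, downSize_withBars hi]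
    omega
  · simp only [deficit, upSize, downSize, width, withBars, Fin.sum_univ_three]
    interval_cases i <;>
      simp only [Matrix.cons_val, Nat.reduceLeDiff, if_true, if_false, Fin.reduceAdd, zero_add] <;>
      ring_nf <;> norm_num

theorem IsQuasiRegular.exists_eq_withBars (hh : h.IsQuasiRegular) : ∃ r i z : ℕ, ∃ v : Vertex,
    1 ≤ r ∧ i ≤ 6 ∧ h = (Hexagon.rotate^[z] (withBars r i)).translate v := by
  obtain ⟨h_sizes, h_widths⟩ := hh.abs_sub_le_one
  obtain ⟨r, i, hr, hi, h_perimeter⟩ :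
      ∃ r i : ℕ, 1 ≤ r ∧ i ≤ 6 ∧ h.perimeter = 6 * r + i := by
    have := hh.1
    exact ⟨(h.perimeter / 6).toNat, (h.perimeter % 6).toNat, by omega, by omega, by omega⟩
  obtain ⟨j, hj⟩ := exists_shift_of_abs_sub_le_one h_widths
  obtain ⟨z, hz, hz_even⟩ :=
    exists_nsmul_one_eq_and_even_iff j (h.upSize = (h.perimeter + 1) / 2)
  have h_width : h.width = (Hexagon.rotate^[z] (withBars r i)).width := by
    funext d
    rw [width_rotate_iterate, width_withBars hi, ← h_perimeter, hz, hj]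
    rfl
  have h_upSize : h.upSize = (Hexagon.rotate^[z] (withBars r i)).upSize := by
    have h_sum := h.perimeter_eq_upSize_add_downSize
    rw [upSize_rotate_iterate, upSize_withBars hi, downSize_withBars hi, ← h_perimeter]
    rw [abs_le] at h_sizes
    split_ifs <;> grind
  obtain ⟨v, hv⟩ := exists_eq_translate h_width h_upSize
  exact ⟨r, i, z, v, hr, hi, hv⟩

theorem image_hexagonWithBars {r i : ℕ} (hr : 1 ≤ r) (hi : i ≤ 6) (z : ℕ) (v : Vertex) :
    (fun f => translateFace v (rotateFace^[z] f)) '' hexagonWithBars r i =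
      ((rotate^[z] (withBars r i)).translate v).faces := by
  rw [hexagonWithBars_eq_faces hr hi, ← Function.comp_def, Set.image_comp,
    image_rotateFace_iterate, image_translateFace]

end Hexagon

theorem isQuasiRegularHexagon_iff {P : Finset Face} :
    IsQuasiRegularHexagon P ↔ ∃ h : Hexagon, h.IsQuasiRegular ∧ P = h.faces := by
  constructor
  · rintro ⟨r, i, z, v, hr, hi, hP⟩
    rw [Hexagon.image_hexagonWithBars hr hi, coe_inj] at hP
    exact ⟨_, ((Hexagon.isQuasiRegular_withBars hr hi).rotate_iterate z).translate v, hP⟩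
  · rintro ⟨h, hh, rfl⟩
    obtain ⟨r, i, z, v, hr, hi, rfl⟩ := hh.exists_eq_withBars
    exact ⟨r, i, z, v, hr, hi, (Hexagon.image_hexagonWithBars hr hi z v).symm⟩

theorem IsPolyiamond.nonempty {P : Finset Face} (hP : IsPolyiamond P) : P.Nonempty :=
  nonempty_coe_sort.1 (SimpleGraph.Connected.nonempty hP)

theorem IsPolyiamond.exists_image_coord_eq_Ico {P : Finset Face} (hP : IsPolyiamond P)
    (d : Fin 3) : ∃ a b, P.image (·.coord d) = Ico a b := by
  apply exists_eq_Ico_of_ordConnected (hP.nonempty.image _)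
  have h_range : ((P.image (·.coord d) : Finset ℤ) : Set ℤ) =
      Set.range fun f : (P : Set Face) => f.1.coord d := by
    rw [coe_image, Set.image_eq_range]
  rw [h_range]
  refine ordConnected_range_of_adj_le_add_one (SimpleGraph.Connected.preconnected hP) ?_
  rintro ⟨f, _⟩ ⟨g, _⟩ ⟨hne, e, hf, hg⟩
  obtain ⟨d', -, rfl : g = neighbor d' f⟩ := exists_eq_neighbor_of_mem_edges hf hg hne.symm
  have h_coord := coord_neighbor d' d f
  dsimp only
  split_ifs at h_coord <;> omega

theorem Hexagon.isTight_of_image_coord_eq_Ico {P : Finset Face} (hP : P.Nonempty) {h : Hexagon}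
    (h_image : ∀ d, P.image (·.coord d) = Ico (h.lower d) (h.upper d)) : h.IsTight := by
  have h_mem {f : Face} (hf : f ∈ P) (d : Fin 3) :
      h.lower d ≤ f.coord d ∧ f.coord d < h.upper d := by
    rw [← mem_Ico, ← h_image]
    exact mem_image_of_mem _ hf
  have h_exists {d : Fin 3} {k : ℤ} (hk : k ∈ Ico (h.lower d) (h.upper d)) :
      ∃ f ∈ P, f.coord d = k := by
    rwa [← h_image, mem_image] at hk
  obtain ⟨g, hg⟩ := hP
  intro d
  have h_g := h_mem hg d
  simp only [width, upSize, downSize, sum_fin_three_shift d]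
  constructor
  · obtain ⟨f, hf, h_top⟩ := h_exists (d := d) (k := h.upper d - 1) (mem_Ico.2 (by omega))
    have h_sum := f.sum_coord
    have h₁ := h_mem hf (d + 1)
    have h₂ := h_mem hf (d + 2)
    rw [sum_fin_three_shift d] at h_sum
    split_ifs at h_sum <;> omega
  · obtain ⟨f, hf, h_bot⟩ := h_exists (d := d) (k := h.lower d) (mem_Ico.2 (by omega))
    have h_sum := f.sum_coord
    have h₁ := h_mem hf (d + 1)
    have h₂ := h_mem hf (d + 2)
    rw [sum_fin_three_shift d] at h_sum
    split_ifs at h_sum <;> omega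

theorem IsPolyiamond.exists_hexagon {P : Finset Face} (hP : IsPolyiamond P) :
    ∃ h : Hexagon, h.IsTight ∧ P ⊆ h.faces ∧ h.perimeter ≤ edgePerimeter P := by
  choose lower upper h_image using hP.exists_image_coord_eq_Ico
  have h_tight : (Hexagon.mk lower upper).IsTight :=
    Hexagon.isTight_of_image_coord_eq_Ico hP.nonempty h_image
  refine ⟨⟨lower, upper⟩, h_tight, fun f hf => ?_, ?_⟩
  · exact Hexagon.mem_faces.2 fun d => mem_Ico.1 (h_image d ▸ mem_image_of_mem _ hf)
  · have h_width (d : Fin 3) : (Hexagon.mk lower upper).width d = #(P.image (·.coord d)) := by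
      rw [h_image, Int.card_Ico]
      exact (Int.toNat_of_nonneg (h_tight.width_nonneg d)).symm
    rw [Hexagon.perimeter, sum_congr rfl fun d _ => h_width d]
    exact_mod_cast sum_card_image_coord_le_edgePerimeter P

theorem Hexagon.IsQuasiRegular.perimeter_le_of_card_le {e h : Hexagon} (he : e.IsQuasiRegular)
    (hh : h.IsTight) (h_card : #e.faces ≤ #h.faces) : e.perimeter ≤ h.perimeter := by
  by_contra! h_lt
  have h_nonneg : 0 ≤ h.perimeter := sum_nonneg fun d _ => hh.width_nonneg d
  have h_card_e := he.isTight.six_mul_card_faces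
  have h_card_h := hh.six_mul_card_faces
  have h_sq : h.perimeter ^ 2 ≤ (e.perimeter - 1) ^ 2 := pow_le_pow_left₀ h_nonneg (by omega) 2
  have h_deficit := h.deficit_nonneg
  obtain ⟨h_six, h_seven⟩ := he
  nlinarith

theorem Hexagon.IsQuasiRegular.of_perimeter_eq {e h : Hexagon} (he : e.IsQuasiRegular)
    (hh : h.IsTight) (h_card : #e.faces ≤ #h.faces) (h_perimeter : h.perimeter = e.perimeter) :
    h.IsQuasiRegular ∧ #h.faces = #e.faces := by
  have h_card_e := he.isTight.six_mul_card_faces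
  have h_card_h := hh.six_mul_card_faces
  have h_parity := hh.card_faces_modEq_two.trans
    (h_perimeter ▸ he.isTight.card_faces_modEq_two.symm)
  have h_deficit := h.deficit_nonneg
  obtain ⟨h_six, h_seven⟩ := he
  unfold Int.ModEq at h_parity
  rw [h_perimeter] at h_card_h
  have h_card_eq : #h.faces = #e.faces := by omega
  exact ⟨⟨by omega, by omega⟩, h_card_eq⟩

theorem Hexagon.IsQuasiRegular.add_two_le_edgePerimeter {e : Hexagon} (he : e.IsQuasiRegular)
    {P : Finset Face} (hP : IsPolyiamond P) (hPE : ¬ IsQuasiRegularHexagon P)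
    (hA : #P = #e.faces) : e.perimeter + 2 ≤ edgePerimeter P := by
  obtain ⟨h, hh, h_subset, h_perimeter⟩ := hP.exists_hexagon
  have h_card : #e.faces ≤ #h.faces := hA ▸ card_le_card h_subset
  have h_le := he.perimeter_le_of_card_le hh h_card
  have h_ne : h.perimeter ≠ e.perimeter := by
    intro h_eq
    obtain ⟨hh', h_card'⟩ := he.of_perimeter_eq hh h_card h_eq
    have h_faces := eq_of_subset_of_card_le h_subset (h_card'.trans hA.symm).le
    exact hPE (isQuasiRegularHexagon_iff.2 ⟨h, hh', h_faces⟩)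
  have h_parity : edgePerimeter P ≡ e.perimeter [ZMOD 2] := by
    have h_area := Int.natCast_modEq_iff.2 (edgePerimeter_modEq_area P)
    rw [area, hA] at h_area
    exact h_area.trans he.isTight.card_faces_modEq_two
  unfold Int.ModEq at h_parity
  omega

end Polyiamond

theorem mainTheorem10 (E P : Finset Polyiamond.Face)
    (hE : Polyiamond.IsQuasiRegularHexagon E)
    (hP : Polyiamond.IsPolyiamond P)
    (hPE : ¬ Polyiamond.IsQuasiRegularHexagon P)
    (hA : Polyiamond.area P = Polyiamond.area E) :
    Polyiamond.edgePerimeter E + 2 ≤ Polyiamond.edgePerimeter P := by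
  obtain ⟨e, he, rfl⟩ := Polyiamond.isQuasiRegularHexagon_iff.1 hE
  have h_upper := he.isTight.edgePerimeter_faces_le
  have h_lower := he.add_two_le_edgePerimeter hP hPE hA
  omega
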